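/- Let $\mathbb V$ be a congruence modular variety of (finitary) universal algebras, i.e. a variety such that the lattice of congruences of every algebra of $\mathbb V$ is modular, and let $Y$ be an algebra of $\mathbb V$. Let $Pt_Y\mathbb V$ be the category whose objects are the homomorphisms $X\to Y$ equipped with a chosen section, and whose morphisms are the homomorphisms over $Y$ commuting with the chosen sections; it is finitely complete and pointed. Then $Pt_Y\mathbb V$ satisfies Axiom $\ast$. Explicitly, for a map $f$ let $R[f]$ be its kernel equivalence relation. For equivalence relations $R,S$ on an object $W$, let $R\,\square\, S$ be the inverse image of $S\times S$ along $R\rightarrowtail W\times W$ (the object of quadruples $(x,y,t,z)$ with $xRy$, $tRz$, $xSt$, $ySz$), let $R\times_1 S$ be the pullback of $d_1:R\to W$ and $d_0:S\to W$, and let $\zeta_{R,S}:R\,\square\, S\to R\times_1 S$ be the map $(x,y,t,z)\mapsto (xRySz)$. Let $(\pi_0,\pi_1):W\rightarrowtail X\times Z$ be any relation in $Pt_Y\mathbb V$ which is - right punctual: there is $t:Z\to W$ with $\pi_1 t=1_Z$ and $\pi_0 t=0$; - difunctional: $R[\pi_0]\cap R[\pi_1]$ is the diagonal of $W$ and $\zeta_{R[\pi_0],R[\pi_1]}$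 is an isomorphism; and let $T$ be any equivalence relation on $W$ in $Pt_Y\mathbb V$. Then $\zeta_{R[\pi_0],T}:R[\pi_0]\,\square\, T\to R[\pi_0]\times_1 T$ is an extremal epimorphism in $Pt_Y\mathbb V$ (this is Axiom $\ast$), and the equivalence relations $R[\pi_0]$ and $T$ permute: $R[\pi_0]\circ T=T\circ R[\pi_0]$ as relations on the underlying set of $W$. -/

import Mathlib

open CategoryTheory CategoryTheory.Limits

universe u v w

noncomputable section

/-! ### Varieties of universal algebra and their congruences -/

/-- A congruence on an algebra `A`: an equivalence relation compatible with all operations. -/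
structure AlgCongruence (L : FirstOrder.Language.{u, v}) (A : Type w) [L.Structure A] extends Setoid A where
  map_fun : ∀ {n : ℕ} (f : L.Functions n) (x y : Fin n → A),
    (∀ i, r (x i) (y i)) → r (FirstOrder.Language.Structure.funMap f x) (FirstOrder.Language.Structure.funMap f y)

namespace AlgCongruence

variable {L : FirstOrder.Language.{u, v}} {A : Type w} [L.Structure A]

theorem toSetoid_injective :
    Function.Injective (AlgCongruence.toSetoid : AlgCongruence L A → Setoid A) := by
  rintro ⟨s, hs⟩ ⟨t, ht⟩ h
  cases h
  rfl

/-- Congruences are ordered by inclusion. -/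
instance : PartialOrder (AlgCongruence L A) :=
  PartialOrder.lift AlgCongruence.toSetoid toSetoid_injective

instance : InfSet (AlgCongruence L A) where
  sInf S :=
    { toSetoid := sInf (AlgCongruence.toSetoid '' S)
      map_fun := by
        rintro n f x y h _ ⟨c, hc, rfl⟩
        exact c.map_fun f x y fun i => h i _ ⟨c, hc, rfl⟩ }

/-- The complete lattice of congruences of `A`; infima are intersections. -/
instance : CompleteLattice (AlgCongruence L A) :=
  completeLatticeOfInf (AlgCongruence L A) fun S => by
    refine ⟨fun c hc => ?_, fun c hc => ?_⟩
    · exact sInf_le (a := c.toSetoid) ⟨c, hc, rfl⟩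
    · refine le_sInf (a := c.toSetoid) ?_
      rintro _ ⟨d, hd, rfl⟩
      exact hc hd

end AlgCongruence

/-- A variety of algebras with (finitary) operations `L`, given by a set of identities `s ≈ t`
between terms. -/
structure AlgVariety (L : FirstOrder.Language.{u, v}) where
  /-- the identities, as pairs of terms in countably many variables -/
  identities : Set (L.Term ℕ × L.Term ℕ)

/-- The algebras of a variety. The empty algebra is allowed (when `L` has no constants). -/
structure AlgVariety.Algebra {L : FirstOrder.Language.{u, v}} (V : AlgVariety L) where
  /-- the underlying set -/
  carrier : Type w
  [str : L.Structure carrier]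
  satisfies : ∀ e ∈ V.identities, ∀ x : ℕ → carrier, e.1.realize x = e.2.realize x

namespace AlgVariety

variable {L : FirstOrder.Language.{u, v}} (V : AlgVariety L)

instance : CoeSort (Algebra.{u, v, w} V) (Type w) := ⟨Algebra.carrier⟩

instance (A : Algebra.{u, v, w} V) : L.Structure A := A.str

/-- The category of algebras of the variety and their homomorphisms. -/
instance : Category (Algebra.{u, v, w} V) where
  Hom A B := L.Hom A B
  id A := FirstOrder.Language.Hom.id L A
  comp f g := g.comp f

instance : ConcreteCategory (Algebra.{u, v, w} V) (fun A B => L.Hom A B) where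
  hom f := f
  ofHom f := f

/-- A variety is congruence modular when the congruence lattices of all its algebras satisfy
the modular law. -/
def IsCongruenceModular : Prop :=
  ∀ A : Algebra.{u, v, w} V, IsModularLattice (AlgCongruence L A)

variable {V}

section Limits

variable [L.IsAlgebraic] {J : Type} [SmallCategory J] (F : J ⥤ Algebra.{u, v, w} V)

/-- The algebra of compatible families of a diagram of algebras. -/
def limitAlgebra : Algebra.{u, v, w} V where
  carrier := {x : ∀ j, F.obj j // ∀ {i j : J} (a : i ⟶ j), F.map a (x i) = x j}
  str :=
    { funMap := fun f x => ⟨fun j => FirstOrder.Language.Structure.funMap f fun i => (x i).1 j, by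
        intro i j a
        have h := FirstOrder.Language.HomClass.map_fun (L := L) (F := L.Hom (F.obj i) (F.obj j)) (F.map a) f
          (fun k => (x k).1 i)
        refine h.trans ?_
        congr 1
        funext k
        exact (x k).2 a⟩
      RelMap := fun r _ => isEmptyElim r }
  satisfies e he x := by
    let _ : L.Structure {x : ∀ j, F.obj j // ∀ {i j : J} (a : i ⟶ j), F.map a (x i) = x j} :=
    { funMap := fun f x => ⟨fun j => FirstOrder.Language.Structure.funMap f fun i => (x i).1 j, by
        intro i j a
        have h := FirstOrder.Language.HomClass.map_fun (L := L) (F := L.Hom (F.obj i) (F.obj j)) (F.map a) f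
          (fun k => (x k).1 i)
        refine h.trans ?_
        congr 1
        funext k
        exact (x k).2 a⟩
      RelMap := fun r _ => isEmptyElim r }
    have key : ∀ (t : L.Term ℕ) (j : J), (t.realize x).1 j = t.realize fun n => (x n).1 j := by
      intro t j
      induction t with
      | var n => rfl
      | func f ts ih =>
        change FirstOrder.Language.Structure.funMap f (fun i => ((ts i).realize x).1 j) = _
        simp only [ih, FirstOrder.Language.Term.realize_func]
    apply Subtype.ext
    funext j
    exact (key _ j).trans (((F.obj j).satisfies e he _).trans (key _ j).symm)

/-- The limit cone on `limitAlgebra`. -/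
def limitCone : Cone F where
  pt := limitAlgebra F
  π :=
    { app := fun j =>
        ({ toFun := fun x => x.1 j
           map_fun' := fun _ _ => rfl
           map_rel' := fun r => isEmptyElim r } : L.Hom (limitAlgebra F) (F.obj j))
      naturality := fun i j a => by
        apply FirstOrder.Language.Hom.ext
        intro x
        exact (x.2 a).symm }

/-- `limitCone` is a limit. -/
def limitConeIsLimit : IsLimit (limitCone F) where
  lift s :=
    ({ toFun := fun x => ⟨fun j => s.π.app j x, fun {i j} a =>
          congrArg (fun h : s.pt ⟶ F.obj j => h x) (s.w a)⟩
       map_fun' := fun f x => by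
        apply Subtype.ext
        funext j
        exact FirstOrder.Language.HomClass.map_fun (L := L) (F := L.Hom (s.pt) (F.obj j)) (s.π.app j) f x
       map_rel' := fun r => isEmptyElim r } : L.Hom s.pt (limitAlgebra F))
  fac s j := rfl
  uniq s m h := by
    apply FirstOrder.Language.Hom.ext
    intro x
    apply Subtype.ext
    funext j
    exact congrArg (fun g : s.pt ⟶ F.obj j => g x) (h j)

end Limits

/-- The category of algebras of a variety is finitely complete. -/
instance [L.IsAlgebraic] : HasFiniteLimits (Algebra.{u, v, w} V) where
  out _ _ _ := ⟨fun F => ⟨⟨⟨limitCone F, limitConeIsLimit F⟩⟩⟩⟩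

end AlgVariety

/-! ### The fibres of the fibration of points -/

section Fibre

variable {C : Type u} [Category.{v} C]

/-- The fibre `Pt_Y C` of the fibration of points above `Y`: the coslice under `1_Y` of the
slice `C / Y`. Its objects are the split epimorphisms `X ⟶ Y` with a chosen section, its
morphisms are the morphisms over `Y` which commute with the sections. -/
abbrev PtFibre (Y : C) := Under (Over.mk (𝟙 Y))

variable (Y : C)

instance [HasFiniteLimits C] : HasFiniteLimits (PtFibre Y) where
  out J _ _ :=
    inferInstanceAs (HasLimitsOfShape J (StructuredArrow (Over.mk (𝟙 Y)) (𝟭 (Over Y))))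

/-- The identity of `Y` is both initial and terminal in `Pt_Y C`. -/
theorem PtFibre.isZero_id : IsZero (Under.mk (𝟙 (Over.mk (𝟙 Y))) : PtFibre Y) := by
  refine ⟨fun X => ⟨⟨⟨Under.homMk X.hom (by simp)⟩, fun f => ?_⟩⟩, fun X => ⟨⟨⟨Under.homMk
    (Over.mkIdTerminal.from X.right) (Over.mkIdTerminal.hom_ext _ _)⟩, fun f => ?_⟩⟩⟩
  · apply Under.UnderMorphism.ext
    have := Under.w f
    simpa using this
  · apply Under.UnderMorphism.ext
    exact Over.mkIdTerminal.hom_ext _ _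

instance : HasZeroObject (PtFibre Y) := ⟨⟨_, PtFibre.isZero_id Y⟩⟩

instance : HasZeroMorphisms (PtFibre Y) := HasZeroObject.zeroMorphismsOfZeroObject

end Fibre

/-! ### Internal equivalence relations -/

section Relations

variable {C : Type u} [Category.{v} C] [HasFiniteLimits C]

/-- An internal equivalence relation `(d₀, d₁) : E ↣ X × X` on `X`. -/
structure InternalEquiv (X : C) where
  obj : C
  d₀ : obj ⟶ X
  d₁ : obj ⟶ X
  mono : Mono (prod.lift d₀ d₁)
  refl : ∃ s : X ⟶ obj, s ≫ d₀ = 𝟙 X ∧ s ≫ d₁ = 𝟙 X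
  symm : ∃ σ : obj ⟶ obj, σ ≫ d₀ = d₁ ∧ σ ≫ d₁ = d₀
  trans : ∃ τ : pullback d₁ d₀ ⟶ obj,
    τ ≫ d₀ = pullback.fst d₁ d₀ ≫ d₀ ∧ τ ≫ d₁ = pullback.snd d₁ d₀ ≫ d₁

attribute [instance] InternalEquiv.mono

namespace InternalEquiv

/-- The kernel equivalence relation `R[f]` of `f : X ⟶ Y`. -/
def ker {X Y : C} (f : X ⟶ Y) : InternalEquiv X where
  obj := pullback f f
  d₀ := pullback.fst f f
  d₁ := pullback.snd f f
  mono := ⟨fun a b h => pullback.hom_ext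
    (by simpa only [Category.assoc, prod.lift_fst] using congrArg (· ≫ prod.fst) h)
    (by simpa only [Category.assoc, prod.lift_snd] using congrArg (· ≫ prod.snd) h)⟩
  refl := ⟨pullback.lift (𝟙 X) (𝟙 X) rfl, pullback.lift_fst _ _ _, pullback.lift_snd _ _ _⟩
  symm := ⟨pullback.lift (pullback.snd f f) (pullback.fst f f) pullback.condition.symm,
    pullback.lift_fst _ _ _, pullback.lift_snd _ _ _⟩
  trans := ⟨pullback.lift (pullback.fst _ _ ≫ pullback.fst f f)
    (pullback.snd _ _ ≫ pullback.snd f f) (by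
      rw [Category.assoc, Category.assoc, pullback.condition, ← pullback.condition (f := f) (g := f),
        ← pullback.condition_assoc, pullback.condition (f := f) (g := f)]),
    pullback.lift_fst _ _ _, pullback.lift_snd _ _ _⟩

variable {X : C} (R S : InternalEquiv X)

/-- `R □ S`: the inverse image of the relation `S × S` on `X × X` along `(d₀, d₁) : R ↣ X × X`.
In set-theoretical terms it consists of the quadruples `(x, y, t, z)` with
`x R y`, `t R z`, `x S t` and `y S z`. -/
abbrev square : C :=
  pullback (prod.map (prod.lift R.d₀ R.d₁) (prod.lift R.d₀ R.d₁))
    (prod.lift (prod.map S.d₀ S.d₀) (prod.map S.d₁ S.d₁))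

/-- The first edge `x R y` of an element `(x, y, t, z)` of `R □ S`. -/
def squareFst : square R S ⟶ R.obj := pullback.fst _ _ ≫ prod.fst

/-- The second edge `y S z` of an element `(x, y, t, z)` of `R □ S`. -/
def squareSnd : square R S ⟶ S.obj := pullback.snd _ _ ≫ prod.snd

theorem square_condition : squareFst R S ≫ R.d₁ = squareSnd R S ≫ S.d₀ := by
  have h := pullback.condition
    (f := prod.map (prod.lift R.d₀ R.d₁) (prod.lift R.d₀ R.d₁))
    (g := prod.lift (prod.map S.d₀ S.d₀) (prod.map S.d₁ S.d₁))
  have h' := congrArg (fun k => k ≫ prod.fst ≫ prod.snd) h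
  simpa only [squareFst, squareSnd, Category.assoc, prod.map_fst_assoc, prod.lift_snd,
    prod.lift_fst_assoc, prod.map_snd] using h'

/-- The canonical factorization `ζ : R □ S ⟶ R ×₁ S`, `(x, y, t, z) ↦ x R y S z`, where
`R ×₁ S` is the pullback of `d₁ : R ⟶ X` and `d₀ : S ⟶ X`. -/
def zeta : square R S ⟶ pullback R.d₁ S.d₀ :=
  pullback.lift (squareFst R S) (squareSnd R S) (square_condition R S)

/-- `R` and `S` have a sharp intersection: `R ∩ S` is the diagonal of `X` and `ζ` is an
isomorphism. -/
structure IsSharp : Prop where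
  inter : Subobject.mk (prod.lift R.d₀ R.d₁) ⊓
    Subobject.mk (prod.lift S.d₀ S.d₁) = Subobject.mk (diag X)
  isIso : IsIso (zeta R S)

end InternalEquiv

/-- The span `(f, g) : W ⟶ X × Z` is a relation. -/
def IsRelationSpan {W X Z : C} (f : W ⟶ X) (g : W ⟶ Z) : Prop := Mono (prod.lift f g)

/-- The span `(f, g)` is right punctual: `g` has a section `t` with `f t = 0`. -/
def IsRightPunctual [HasZeroMorphisms C] {W X Z : C} (f : W ⟶ X) (g : W ⟶ Z) : Prop :=
  ∃ t : Z ⟶ W, t ≫ g = 𝟙 Z ∧ t ≫ f = 0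

/-- The relation `(f, g)` is difunctional: `R[f]` and `R[g]` have a sharp intersection. -/
def IsDifunctional {W X Z : C} (f : W ⟶ X) (g : W ⟶ Z) : Prop :=
  InternalEquiv.IsSharp (InternalEquiv.ker f) (InternalEquiv.ker g)

variable (C) in
/-- Axiom ∗ for a pointed category: for every right punctual difunctional relation
`(f, g) : W ↣ X × Z` and every equivalence relation `T` on `W`, the canonical factorization
`R[f] □ T ⟶ R[f] ×₁ T` is an extremal epimorphism. -/
def AxiomStar [HasZeroObject C] [HasZeroMorphisms C] : Prop :=
  ∀ ⦃W X Z : C⦄ (f : W ⟶ X) (g : W ⟶ Z), IsRelationSpan f g → IsRightPunctual f g →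
    IsDifunctional f g → ∀ T : InternalEquiv W,
      ExtremalEpi (InternalEquiv.zeta (InternalEquiv.ker f) T)

end Relations

/-- The relation on the underlying set of `W` given by an internal equivalence relation `T` on
an object `W` of `Pt_Y V`. -/
def AlgVariety.ptRel {L : FirstOrder.Language.{u, v}} [L.IsAlgebraic] {V : AlgVariety L}
    {Y : AlgVariety.Algebra.{u, v, w} V} {W : PtFibre Y} (T : InternalEquiv W) :
    W.right.left → W.right.left → Prop :=
  fun a b => ∃ t : T.obj.right.left, T.d₀.right.left t = a ∧ T.d₁.right.left t = b

end

/-!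
Write `a`, `b`, `c` for the congruences `R[π₀]`, `R[π₁]` and `T` on the algebra of `W`. They are all
contained in the kernel `e` of the zero map `W ⟶ X`. Since `(π₀, π₁)` is a relation, `a ⊓ b = ⊥`;
right punctuality and difunctionality give `e ⊆ a ∘ b`: for `x e y`, the elements `t (π₁ x)` and
`t (π₁ y)` have the same image under `π₀`, and the fourth vertex of the square on
`t (π₁ y) a t (π₁ x) b x` links `x` to `y`.

Let `x a y c z`. Day's operations `m₀, …, mₙ` of a congruence modular variety lead from the first
to the last projection. One follows the elements `mᵢ(y, y, z, z)` from `y` to `z`, carrying along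
an element of the current `a`-class without leaving the `c`-class of `x`. Consecutive `mᵢ` agree
either on `(y, y, z, z)` or on `(y, y, y, z)`, and the passage between these two tuples is a term
condition which follows from Gumm's shifting lemma because `a ⊓ b = ⊥` and `e ⊆ a ∘ b`. Hence
`a ∘ c ⊆ c ∘ a`, which says that `ζ` is surjective.
-/

open FirstOrder FirstOrder.Language.Structure Function Relation

theorem rel_of_forall_update {ι α β : Type*} [Finite ι] [DecidableEq ι] {r : α → α → Prop}
    {s : β → β → Prop} [IsPreorder β s] (f : (ι → α) → β)
    (hf : ∀ (x : ι → α) (i : ι) (a b : α), r a b → s (f (update x i a)) (f (update x i b)))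
    {x y : ι → α} (h : ∀ i, r (x i) (y i)) : s (f x) (f y) := by
  have := Fintype.ofFinite ι
  have replace_on (t : Finset ι) : s (f x) (f (t.piecewise y x)) := by
    induction t using Finset.induction_on with
    | empty => simpa only [Finset.piecewise_empty] using refl_of s (f x)
    | insert i t hi ih =>
      have hx : update (t.piecewise y x) i (x i) = t.piecewise y x :=
        update_eq_self_iff.2 (Finset.piecewise_eq_of_notMem _ _ _ hi).symm
      have hstep := hf (t.piecewise y x) i (x i) (y i) (h i)
      rw [hx, ← Finset.piecewise_insert] at hstep
      exact trans_of s ih hstep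
  simpa only [Finset.piecewise_univ] using replace_on Finset.univ

namespace AlgCongruence

variable {L : FirstOrder.Language.{u, v}} {A : Type w} [L.Structure A]

theorem inf_r {c d : AlgCongruence L A} {x y : A} : (c ⊓ d).r x y ↔ c.r x y ∧ d.r x y := by
  refine ⟨fun h => ⟨(inf_le_left : c ⊓ d ≤ c) h, (inf_le_right : c ⊓ d ≤ d) h⟩, fun h => ?_⟩
  let e : AlgCongruence L A :=
    { toSetoid := c.toSetoid ⊓ d.toSetoid
      map_fun := fun f x y h =>
        ⟨c.map_fun f x y fun i => (h i).1, d.map_fun f x y fun i => (h i).2⟩ }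
  exact (le_inf (fun _ _ h => h.1) (fun _ _ h => h.2) : e ≤ c ⊓ d) h

theorem eq_of_bot_r {x y : A} (h : (⊥ : AlgCongruence L A).r x y) : x = y :=
  let e : AlgCongruence L A :=
    { toSetoid := ⊥
      map_fun := fun f _ _ h => congrArg (funMap f) (funext h) }
  (bot_le : ⊥ ≤ e) h

theorem disjoint_iff_eq {a b : AlgCongruence L A} :
    Disjoint a b ↔ ∀ x y, a.r x y → b.r x y → x = y := by
  rw [disjoint_iff_inf_le]
  refine ⟨fun h x y ha hb => eq_of_bot_r (h (inf_r.2 ⟨ha, hb⟩)), fun h x y hxy => ?_⟩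
  obtain ⟨ha, hb⟩ := inf_r.1 hxy
  exact h x y ha hb ▸ (⊥ : AlgCongruence L A).iseqv.refl x

theorem shifting_lemma [IsModularLattice (AlgCongruence L A)] {a b c : AlgCongruence L A}
    (hc : a ⊓ b ≤ c) {x y x' y' : A} (hx : a.r x x') (hy : a.r y y') (hb : b.r x y)
    (hb' : b.r x' y') (h : c.r x y) : c.r x' y' := by
  let d := b ⊓ c ⊔ a
  have ha : a ≤ d := le_sup_right
  have hbc : d.r x y := (le_sup_left : b ⊓ c ≤ d) (inf_r.2 ⟨hb, h⟩)
  have hd : d.r x' y' := d.iseqv.trans (ha (a.iseqv.symm hx)) (d.iseqv.trans hbc (ha hy))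
  have hdb : d ⊓ b ≤ c :=
    (IsModularLattice.sup_inf_le_assoc_of_le a inf_le_left).trans (sup_le inf_le_right hc)
  exact hdb (inf_r.2 ⟨hd, hb'⟩)

end AlgCongruence

/-- An operation of arity `ι` on `A` that preserves every congruence of `A`. Such operations
play the role of terms: on an algebra of a variety they form again an algebra of the variety, so
that no free algebra is needed. -/
@[ext]
structure CongruencePreserving (L : FirstOrder.Language.{u, v}) (A : Type w) [L.Structure A]
    (ι : Type*) where
  toFun : (ι → A) → A
  map_rel : ∀ (c : AlgCongruence L A) {x y : ι → A}, (∀ i, c.r (x i) (y i)) →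
    c.r (toFun x) (toFun y)

namespace CongruencePreserving

variable {L : FirstOrder.Language.{u, v}} {A : Type w} [L.Structure A] {ι : Type*}

instance : CoeFun (CongruencePreserving L A ι) fun _ => (ι → A) → A := ⟨toFun⟩

theorem map_update_rel [DecidableEq ι] (φ : CongruencePreserving L A ι) (c : AlgCongruence L A)
    {x y : ι → A} (h : ∀ i, c.r (x i) (y i)) (i : ι) {p q : A} (hpq : c.r p q) :
    c.r (φ (update x i p)) (φ (update y i q)) :=
  φ.map_rel c fun j => by
    by_cases hj : j = i
    · subst hj
      simpa only [update_self] using hpq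
    · simpa only [update_of_ne hj] using h j

/-- A basic operation of the algebra. -/
def ofFunction {n : ℕ} (f : L.Functions n) : CongruencePreserving L A (Fin n) :=
  ⟨funMap f, fun c _ _ => c.map_fun f _ _⟩

/-- The projection onto the coordinate `i`. -/
def proj (i : ι) : CongruencePreserving L A ι := ⟨fun x => x i, fun _ _ _ h => h i⟩

instance [L.IsAlgebraic] : L.Structure (CongruencePreserving L A ι) where
  funMap f φ := ⟨fun x => funMap f fun i => φ i x, fun c _ _ h =>
    c.map_fun f _ _ fun i => (φ i).map_rel c h⟩
  RelMap r _ := isEmptyElim r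

/-- Evaluation of operations at a tuple. -/
def eval [L.IsAlgebraic] (x : ι → A) : L.Hom (CongruencePreserving L A ι) A where
  toFun φ := φ x
  map_fun' _ _ := rfl
  map_rel' r := isEmptyElim r

/-- The congruence identifying two operations that agree on `S`. -/
def agreeOn [L.IsAlgebraic] (S : Set (ι → A)) : AlgCongruence L (CongruencePreserving L A ι) where
  r φ ψ := Set.EqOn φ ψ S
  iseqv := ⟨fun _ => Set.eqOn_refl _ _, Set.EqOn.symm, Set.EqOn.trans⟩
  map_fun f _ _ h _ hx := congrArg (funMap f) (funext fun i => h i hx)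

end CongruencePreserving

namespace AlgCongruence

variable {L : FirstOrder.Language.{u, v}} {A : Type w} [L.Structure A]

theorem reflTransGen_of_sup_r {c d : AlgCongruence L A} {x y : A}
    (h : (c ⊔ d).r x y) : ReflTransGen (fun x y => c.r x y ∨ d.r x y) x y := by
  have symm_union : Std.Symm fun x y => c.r x y ∨ d.r x y :=
    ⟨fun _ _ => Or.imp c.iseqv.symm d.iseqv.symm⟩
  let e : AlgCongruence L A :=
    { r := ReflTransGen fun x y => c.r x y ∨ d.r x y
      iseqv := ⟨fun _ => .refl, ReflTransGen.stdSymm.symm _ _, .trans⟩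
      map_fun := fun f _ _ h => rel_of_forall_update (funMap f) (fun x i p q hpq =>
        have update_r (c : AlgCongruence L A) {p q : A} : c.r p q → _ :=
          (CongruencePreserving.ofFunction f).map_update_rel c (fun j => c.iseqv.refl (x j)) i
        hpq.lift (fun p => funMap f (update x i p)) fun _ _ =>
          Or.imp (update_r c) (update_r d)) h }
  exact (sup_le (fun _ _ h => .single (.inl h)) (fun _ _ h => .single (.inr h)) : c ⊔ d ≤ e) h

/-- Every element of the `a`-class of `s` is `c`-related to an element of the `a`-class of `t`. -/
def Reaches (a c : AlgCongruence L A) (s t : A) : Prop :=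
  ∀ r, a.r r s → Comp c.r a.r r t

theorem Reaches.refl (a c : AlgCongruence L A) (s : A) : Reaches a c s s :=
  fun r hr => ⟨r, c.iseqv.refl r, hr⟩

theorem Reaches.trans {a c : AlgCongruence L A} {s t q : A} (hst : Reaches a c s t)
    (htq : Reaches a c t q) : Reaches a c s q := by
  intro r hr
  obtain ⟨r', hrr', hr't⟩ := hst r hr
  obtain ⟨r'', hr'r'', hr''q⟩ := htq r' hr't
  exact ⟨r'', c.iseqv.trans hrr' hr'r'', hr''q⟩

/-- The term condition of commutator theory, up to `Reaches`. The tuple `q` between `t` and `s`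
has the same value as `s` at `y`, and the shifting lemma carries this over to `z`. -/
theorem reaches_of_update_eq [IsModularLattice (AlgCongruence L A)] {a b c : AlgCongruence L A}
    (hab : Disjoint a b) (hdec : (a ⊔ c).r ≤ Comp a.r b.r) {ι : Type*} [DecidableEq ι]
    (φ : CongruencePreserving L A ι) {s t : ι → A} (hst : ∀ j, (a ⊔ c).r (t j) (s j)) (i : ι)
    {y z : A} (hyz : c.r y z) (heq : φ (update s i y) = φ (update t i y)) :
    Reaches a c (φ (update s i z)) (φ (update t i z)) := by
  choose q htq hqs using fun j => hdec _ _ (hst j)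
  have hφq : φ (update q i y) = φ (update s i y) :=
    disjoint_iff_eq.1 hab _ _
      (heq ▸ φ.map_update_rel a (fun j => a.iseqv.symm (htq j)) i (a.iseqv.refl y))
      (φ.map_update_rel b hqs i (b.iseqv.refl y))
  have change_y (x : ι → A) : c.r (φ (update x i y)) (φ (update x i z)) :=
    φ.map_update_rel c (fun j => c.iseqv.refl (x j)) i hyz
  have hc : c.r (φ (update s i z)) (φ (update q i z)) :=
    c.iseqv.trans (c.iseqv.symm (change_y s)) (hφq ▸ change_y q)
  have hb : b.r (φ (update s i z)) (φ (update q i z)) :=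
    φ.map_update_rel b (fun j => b.iseqv.symm (hqs j)) i (b.iseqv.refl z)
  have ha : a.r (φ (update q i z)) (φ (update t i z)) :=
    φ.map_update_rel a (fun j => a.iseqv.symm (htq j)) i (a.iseqv.refl z)
  intro r hr
  have hac : (a ⊔ c).r (φ (update t i z)) r :=
    (a ⊔ c).iseqv.symm <| (a ⊔ c).iseqv.trans ((le_sup_left : a ≤ a ⊔ c) hr) <|
      (a ⊔ c).iseqv.trans ((le_sup_right : c ≤ a ⊔ c) hc) ((le_sup_left : a ≤ a ⊔ c) ha)
  obtain ⟨r', htr', hr'r⟩ := hdec _ _ hac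
  exact ⟨r', shifting_lemma (hab.le_bot.trans bot_le) (a.iseqv.symm hr) (a.iseqv.trans ha htr') hb
    (b.iseqv.symm hr'r) hc, a.iseqv.symm htr'⟩

end AlgCongruence

namespace AlgVariety

variable {L : FirstOrder.Language.{u, v}} {V : AlgVariety L}

theorem satisfies_of_jointly_injective {B κ : Type*} [L.Structure B]
    (A : κ → Algebra.{u, v, w} V) (g : ∀ k, L.Hom B (A k))
    (hg : ∀ b b', (∀ k, g k b = g k b') → b = b') :
    ∀ e ∈ V.identities, ∀ x : ℕ → B, e.1.realize x = e.2.realize x := by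
  refine fun e he x => hg _ _ fun k => ?_
  rw [← Language.HomClass.realize_term, ← Language.HomClass.realize_term]
  exact (A k).satisfies e he _

/-- The algebra of congruence preserving operations of arity `ι` on an algebra of `V`. -/
def preservingAlgebra [L.IsAlgebraic] (A : Algebra.{u, v, w} V) (ι : Type*) : Algebra V where
  carrier := CongruencePreserving L A ι
  satisfies := satisfies_of_jointly_injective (fun _ => A) CongruencePreserving.eval
    fun _ _ h => CongruencePreserving.ext (funext h)

end AlgVariety

/-! ### Day operations -/

namespace CongruencePreserving

variable {L : FirstOrder.Language.{u, v}} {A : Type w} [L.Structure A]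

/-- The identity `m(x, y, y, x) = x` of Day's terms. -/
def IsDay (m : CongruencePreserving L A (Fin 4)) : Prop :=
  ∀ x y, m ![x, y, y, x] = x

/-- Two consecutive operations in a chain of Day operations. -/
structure DayLinked (φ ψ : CongruencePreserving L A (Fin 4)) : Prop where
  left : φ.IsDay
  right : ψ.IsDay
  link : (∀ x y, φ ![x, x, y, y] = ψ ![x, x, y, y]) ∨ ∀ x y z, φ ![x, y, y, z] = ψ ![x, y, y, z]

/-- A. Day's characterization of congruence modularity, with congruence preserving operations in
place of terms: in the algebra of quaternary operations the modular law is applied to the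
congruences of agreement on the tuples of the form `(x, x, y, y)`, `(x, y, y, x)` and
`(x, y, y, z)`. -/
theorem reflTransGen_dayLinked [L.IsAlgebraic]
    [IsModularLattice (AlgCongruence L (CongruencePreserving L A (Fin 4)))] :
    ReflTransGen DayLinked (proj 0 : CongruencePreserving L A (Fin 4)) (proj 3) := by
  let a : AlgCongruence L (CongruencePreserving L A (Fin 4)) := agreeOn {x | x 0 = x 1 ∧ x 2 = x 3}
  let b : AlgCongruence L (CongruencePreserving L A (Fin 4)) := agreeOn {x | x 0 = x 3 ∧ x 1 = x 2}
  let c : AlgCongruence L (CongruencePreserving L A (Fin 4)) := agreeOn {x | x 1 = x 2}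
  have hcb : c ≤ b := fun _ _ h x hx => h hx.2
  have hca : (c ⊔ a).r (proj 0) (proj 3) := by
    have h01 : a.r (proj 0) (proj 1) := fun x hx => hx.1
    have h12 : c.r (proj 1) (proj 2) := fun x hx => hx
    have h23 : a.r (proj 2) (proj 3) := fun x hx => hx.2
    exact (c ⊔ a).iseqv.trans ((le_sup_right : a ≤ c ⊔ a) h01) <|
      (c ⊔ a).iseqv.trans ((le_sup_left : c ≤ c ⊔ a) h12) ((le_sup_right : a ≤ c ⊔ a) h23)
  have hb : b.r (proj 0) (proj 3) := fun x hx => hx.1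
  have isDay_of_b {φ} (h : b.r (proj 0) φ) : φ.IsDay :=
    fun x y => (h (x := ![x, y, y, x]) ⟨rfl, rfl⟩).symm
  suffices ∀ φ, ReflTransGen (fun φ ψ => c.r φ ψ ∨ (a ⊓ b).r φ ψ) (proj 0) φ →
      b.r (proj 0) φ ∧ ReflTransGen DayLinked (proj 0) φ from
    (this _ (AlgCongruence.reflTransGen_of_sup_r
      (IsModularLattice.sup_inf_le_assoc_of_le a hcb (AlgCongruence.inf_r.2 ⟨hca, hb⟩)))).2
  intro φ hφ
  induction hφ with
  | refl => exact ⟨b.iseqv.refl _, .refl⟩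
  | @tail φ ψ _ hφψ ih =>
    have hψ : b.r (proj 0) ψ := b.iseqv.trans ih.1 <|
      hφψ.elim (fun h => hcb h) fun h => (AlgCongruence.inf_r.1 h).2
    refine ⟨hψ, ih.2.tail ⟨isDay_of_b ih.1, isDay_of_b hψ, ?_⟩⟩
    refine hφψ.symm.imp (fun h x y => ?_) fun h x y z => h (x := ![x, y, y, z]) rfl
    exact (AlgCongruence.inf_r.1 h).1 (x := ![x, x, y, y]) ⟨rfl, rfl⟩

open AlgCongruence

variable {a b c : AlgCongruence L A}

theorem IsDay.reaches {m : CongruencePreserving L A (Fin 4)} (hm : m.IsDay) (s : A) {y z : A}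
    (hyz : c.r y z) : Reaches a c s (m ![s, y, z, s]) := by
  intro r hr
  have hc : c.r (m ![r, y, y, r]) (m ![r, y, z, r]) :=
    m.map_rel c (by simpa [Fin.forall_fin_succ, c.iseqv.refl] using hyz)
  have ha : a.r (m ![r, y, z, r]) (m ![s, y, z, s]) :=
    m.map_rel a (by simpa [Fin.forall_fin_succ, a.iseqv.refl] using hr)
  rw [hm r y] at hc
  exact ⟨_, hc, ha⟩

theorem IsDay.reaches_of_third [IsModularLattice (AlgCongruence L A)]
    (hab : Disjoint a b) (hdec : (a ⊔ c).r ≤ Comp a.r b.r)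
    {m : CongruencePreserving L A (Fin 4)} (hm : m.IsDay) {x y p q z : A}
    (hxy : (a ⊔ c).r x y) (hyp : (a ⊔ c).r y p) (hpz : (a ⊔ c).r p z) (hpq : c.r p q) :
    Reaches a c (m ![x, y, p, z]) (m ![x, y, q, z]) := by
  let d := a ⊔ c
  let u := m ![x, y, p, z]
  have hup : d.r u p := by
    have h : d.r (m ![x, y, p, z]) (m ![p, p, p, p]) := m.map_rel d <| by
      simpa [Fin.forall_fin_succ] using
        ⟨d.iseqv.trans hxy hyp, hyp, d.iseqv.symm hpz⟩
    rwa [hm p p] at h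
  have update_third (s t r r' v : A) : update ![s, t, r, v] 2 r' = ![s, t, r', v] := by
    ext i
    fin_cases i <;> rfl
  -- the frames `(u, p, -, u)` and `(x, y, -, z)` both have the value `u` at `p`
  have change_frame : Reaches a c (m ![u, p, q, u]) (m ![x, y, q, z]) := by
    have related : ∀ j, d.r (![x, y, p, z] j) (![u, p, p, u] j) := by
      simpa [Fin.forall_fin_succ] using
        ⟨d.iseqv.trans (d.iseqv.trans hxy hyp) (d.iseqv.symm hup), hyp,
          d.iseqv.trans (d.iseqv.symm hpz) (d.iseqv.symm hup)⟩
    simpa only [update_third] using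
      reaches_of_update_eq hab hdec m related 2 hpq (by simpa only [update_third] using hm u p)
  exact (hm.reaches u hpq).trans change_frame

theorem DayLinked.reaches [IsModularLattice (AlgCongruence L A)]
    (hab : Disjoint a b) (hdec : (a ⊔ c).r ≤ Comp a.r b.r)
    {φ ψ : CongruencePreserving L A (Fin 4)} (h : DayLinked φ ψ) {y z : A} (hyz : c.r y z) :
    Reaches a c (φ ![y, y, z, z]) (ψ ![y, y, z, z]) := by
  have hy : (a ⊔ c).r y y := (a ⊔ c).iseqv.refl y
  have hyz' : (a ⊔ c).r y z := (le_sup_right : c ≤ a ⊔ c) hyz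
  rcases h.link with h_eq | h_eq
  · exact h_eq y z ▸ Reaches.refl a c _
  · have h_left : Reaches a c (φ ![y, y, z, z]) (φ ![y, y, y, z]) :=
      h.left.reaches_of_third hab hdec hy hyz' ((a ⊔ c).iseqv.refl z) (c.iseqv.symm hyz)
    have h_right : Reaches a c (ψ ![y, y, y, z]) (ψ ![y, y, z, z]) :=
      h.right.reaches_of_third hab hdec hy hy hyz' hyz
    exact h_left.trans (h_eq y y z ▸ h_right)

end CongruencePreserving

namespace AlgVariety

variable {L : FirstOrder.Language.{u, v}} [L.IsAlgebraic] {V : AlgVariety L}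

theorem IsCongruenceModular.comp_le_comp (hV : IsCongruenceModular.{u, v, w} V)
    {A : Algebra.{u, v, w} V} {a b c : AlgCongruence L A} (hab : Disjoint a b)
    (hdec : (a ⊔ c).r ≤ Comp a.r b.r) : Comp a.r c.r ≤ Comp c.r a.r := by
  rintro x z ⟨y, hxy, hyz⟩
  have : IsModularLattice (AlgCongruence L A) := hV A
  have : IsModularLattice (AlgCongruence L (CongruencePreserving L A (Fin 4))) :=
    hV (preservingAlgebra A (Fin 4))
  have reaches (φ : CongruencePreserving L A (Fin 4))
      (hφ : ReflTransGen CongruencePreserving.DayLinked (.proj 0) φ) :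
      AlgCongruence.Reaches a c y (φ ![y, y, z, z]) := by
    induction hφ with
    | refl => exact AlgCongruence.Reaches.refl a c y
    | tail _ h ih => exact ih.trans (h.reaches hab hdec hyz)
  exact reaches (.proj 3) CongruencePreserving.reflTransGen_dayLinked x hxy

end AlgVariety

/-! ### Internal equivalence relations on underlying sets -/
section UnderlyingSets

variable {C : Type u} [Category.{v} C] (U : C ⥤ Type w)

theorem extremalEpi_of_surjective_map [HasEqualizers C] [U.PreservesMonomorphisms]
    [U.ReflectsIsomorphisms] {X Y : C} (f : X ⟶ Y) (hf : Surjective (U.map f)) :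
    ExtremalEpi f := by
  refine ExtremalEpi.mk_of_hasEqualizers f fun Z p i fac _ => ?_
  have hi : Bijective (U.map i) := ⟨(mono_iff_injective _).1 inferInstance, fun y => by
    obtain ⟨x, rfl⟩ := hf y
    exact ⟨U.map p x, by rw [← U.map_comp_apply, fac]⟩⟩
  have : IsIso (U.map i) := (isIso_iff_bijective _).2 hi
  exact isIso_of_reflects_iso i U

variable [HasFiniteLimits C]

theorem map_terminal_eq_of_map_eq {X Y Z : C} {f : X ⟶ Z} {g : Y ⟶ Z} {x : U.obj X} {y : U.obj Y}
    (h : U.map f x = U.map g y) :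
    U.map (terminal.from X) x = U.map (terminal.from Y) y := by
  rw [← terminal.comp_from f, ← terminal.comp_from g, U.map_comp_apply, U.map_comp_apply, h]

namespace InternalEquiv

variable {W : C}

/-- The relation that an internal equivalence relation induces on underlying sets. -/
def rel (T : InternalEquiv W) : U.obj W → U.obj W → Prop :=
  fun a b => ∃ t : U.obj T.obj, U.map T.d₀ t = a ∧ U.map T.d₁ t = b

variable {U} in
theorem comp_rel_of_square (R S : InternalEquiv W) (q : U.obj (square R S)) :
    Comp (S.rel U) (R.rel U) (U.map (squareFst R S ≫ R.d₀) q) (U.map (squareSnd R S ≫ S.d₁) q) := by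
  let xt : square R S ⟶ S.obj := pullback.snd _ _ ≫ prod.fst
  let tz : square R S ⟶ R.obj := pullback.fst _ _ ≫ prod.snd
  have hsquare := pullback.condition
    (f := prod.map (prod.lift R.d₀ R.d₁) (prod.lift R.d₀ R.d₁))
    (g := prod.lift (prod.map S.d₀ S.d₀) (prod.map S.d₁ S.d₁))
  have hx : xt ≫ S.d₀ = squareFst R S ≫ R.d₀ := by
    simpa only [squareFst, xt, Category.assoc, prod.map_fst, prod.lift_fst, prod.map_fst_assoc,
      prod.lift_fst_assoc] using congrArg (· ≫ prod.fst ≫ prod.fst) hsquare.symm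
  have ht : tz ≫ R.d₀ = xt ≫ S.d₁ := by
    simpa only [xt, tz, Category.assoc, prod.map_fst, prod.lift_fst, prod.map_snd_assoc,
      prod.lift_snd_assoc] using congrArg (· ≫ prod.snd ≫ prod.fst) hsquare
  have hz : tz ≫ R.d₁ = squareSnd R S ≫ S.d₁ := by
    simpa only [squareSnd, tz, Category.assoc, prod.map_snd, prod.lift_snd, prod.map_snd_assoc,
      prod.lift_snd_assoc] using congrArg (· ≫ prod.snd ≫ prod.snd) hsquare
  refine ⟨U.map (xt ≫ S.d₁) q, ⟨U.map xt q, ?_, ?_⟩, ⟨U.map tz q, ?_, ?_⟩⟩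
  · simp only [← hx, U.map_comp_apply]
  · simp only [U.map_comp_apply]
  · simp only [← ht, U.map_comp_apply]
  · simp only [← hz, U.map_comp_apply]

end InternalEquiv

variable [PreservesLimitsOfShape WalkingCospan U]

theorem map_prod_ext {X Y : C} {p q : U.obj (X ⨯ Y)}
    (hfst : U.map prod.fst p = U.map prod.fst q) (hsnd : U.map prod.snd p = U.map prod.snd q) :
    p = q :=
  Types.ext_of_isPullback ((IsPullback.of_hasBinaryProduct' X Y).map U) hfst hsnd

theorem exists_map_prod {X Y : C} {x : U.obj X} {y : U.obj Y}
    (h : U.map (terminal.from X) x = U.map (terminal.from Y) y) :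
    ∃ p : U.obj (X ⨯ Y), U.map prod.fst p = x ∧ U.map prod.snd p = y :=
  Types.exists_of_isPullback ((IsPullback.of_hasBinaryProduct' X Y).map U) x y h

theorem exists_map_pullback {X Y Z : C} (f : X ⟶ Z) (g : Y ⟶ Z) {x : U.obj X} {y : U.obj Y}
    (h : U.map f x = U.map g y) :
    ∃ p : U.obj (pullback f g), U.map (pullback.fst f g) p = x ∧ U.map (pullback.snd f g) p = y :=
  Types.exists_of_isPullback ((IsPullback.of_hasPullback f g).map U) x y h

theorem IsRelationSpan.eq_of_map_eq {W X Z : C} {f : W ⟶ X} {g : W ⟶ Z} (hfg : IsRelationSpan f g)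
    {a b : U.obj W} (hf : U.map f a = U.map f b) (hg : U.map g a = U.map g b) : a = b := by
  have : Mono (prod.lift f g) := hfg
  refine (mono_iff_injective (U.map (prod.lift f g))).1 inferInstance (map_prod_ext U ?_ ?_)
  · simpa only [← U.map_comp_apply, prod.lift_fst] using hf
  · simpa only [← U.map_comp_apply, prod.lift_snd] using hg

namespace InternalEquiv

variable {U} {W : C}

theorem rel_ker {X : C} {f : W ⟶ X} {a b : U.obj W} :
    (ker f).rel U a b ↔ U.map f a = U.map f b := by
  refine ⟨?_, exists_map_pullback U f f⟩
  rintro ⟨t, rfl, rfl⟩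
  rw [← U.map_comp_apply, ← U.map_comp_apply]
  exact congrArg (fun k => U.map k t) (pullback.condition (f := f) (g := f))

theorem rel_equivalence (T : InternalEquiv W) : Equivalence (T.rel U) where
  refl a := by
    obtain ⟨s, h₀, h₁⟩ := T.refl
    refine ⟨U.map s a, ?_, ?_⟩ <;> simp only [← U.map_comp_apply, h₀, h₁, U.map_id_apply]
  symm := by
    rintro _ _ ⟨t, rfl, rfl⟩
    obtain ⟨σ, h₀, h₁⟩ := T.symm
    refine ⟨U.map σ t, ?_, ?_⟩ <;> simp only [← U.map_comp_apply, h₀, h₁]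
  trans := by
    rintro _ _ _ ⟨t, rfl, rfl⟩ ⟨t', h, rfl⟩
    obtain ⟨τ, h₀, h₁⟩ := T.trans
    obtain ⟨p, rfl, rfl⟩ := exists_map_pullback U T.d₁ T.d₀ h.symm
    refine ⟨U.map τ p, ?_, ?_⟩ <;> simp only [← U.map_comp_apply, h₀, h₁]

theorem exists_square (R S : InternalEquiv W) {r r' : U.obj R.obj} {s s' : U.obj S.obj}
    (hx : U.map R.d₀ r = U.map S.d₀ s) (hy : U.map R.d₁ r = U.map S.d₀ s')
    (ht : U.map R.d₀ r' = U.map S.d₁ s) (hz : U.map R.d₁ r' = U.map S.d₁ s') :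
    ∃ q : U.obj (square R S), U.map (squareFst R S) q = r ∧ U.map (squareSnd R S) q = s' := by
  obtain ⟨p, rfl, rfl⟩ := exists_map_prod U (x := r) (y := r') <|
    (map_terminal_eq_of_map_eq U hx).trans (map_terminal_eq_of_map_eq U ht).symm
  obtain ⟨p', rfl, rfl⟩ := exists_map_prod U (x := s) (y := s') <|
    (map_terminal_eq_of_map_eq U hx).symm.trans (map_terminal_eq_of_map_eq U hy)
  have hpp' : U.map (prod.map (prod.lift R.d₀ R.d₁) (prod.lift R.d₀ R.d₁)) p =
      U.map (prod.lift (prod.map S.d₀ S.d₀) (prod.map S.d₁ S.d₁)) p' := by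
    simp only [← U.map_comp_apply] at hx hy ht hz
    refine map_prod_ext U (map_prod_ext U ?_ ?_) (map_prod_ext U ?_ ?_) <;>
      simpa only [← U.map_comp_apply, Category.assoc, prod.map_fst, prod.map_snd, prod.lift_fst,
        prod.lift_snd]
  obtain ⟨q, rfl, rfl⟩ := exists_map_pullback U _ _ hpp'
  exact ⟨q, U.map_comp_apply _ _ q, U.map_comp_apply _ _ q⟩

theorem surjective_map_zeta_iff (R S : InternalEquiv W) :
    Surjective (U.map (zeta R S)) ↔
      Comp (R.rel U) (S.rel U) ≤ Comp (S.rel U) (R.rel U) := by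
  have hfst : zeta R S ≫ pullback.fst _ _ = squareFst R S := pullback.lift_fst _ _ _
  have hsnd : zeta R S ≫ pullback.snd _ _ = squareSnd R S := pullback.lift_snd _ _ _
  constructor
  · rintro h _ _ ⟨_, ⟨r, rfl, rfl⟩, s, hs, rfl⟩
    obtain ⟨p, rfl, rfl⟩ := exists_map_pullback U R.d₁ S.d₀ hs.symm
    obtain ⟨q, rfl⟩ := h p
    simpa only [← U.map_comp_apply, ← hfst, ← hsnd, Category.assoc] using comp_rel_of_square R S q
  · intro h p
    have hy : U.map R.d₁ (U.map (pullback.fst _ _) p) =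
        U.map S.d₀ (U.map (pullback.snd _ _) p) := by
      simp only [← U.map_comp_apply, pullback.condition]
    obtain ⟨_, ⟨s, hs, rfl⟩, r', ht, hz⟩ := h _ _ ⟨_, ⟨_, rfl, rfl⟩, _, hy.symm, rfl⟩
    obtain ⟨q, hq, hq'⟩ := exists_square R S hs.symm hy ht hz
    refine ⟨q, Types.ext_of_isPullback ((IsPullback.of_hasPullback R.d₁ S.d₀).map U) ?_ ?_⟩
    · rw [← U.map_comp_apply, hfst, hq]
    · rw [← U.map_comp_apply, hsnd, hq']

variable [HasZeroMorphisms C]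

theorem rel_le_rel_ker_zero (T : InternalEquiv W) (X : C) : T.rel U ≤ (ker (0 : W ⟶ X)).rel U := by
  rintro _ _ ⟨t, rfl, rfl⟩
  rw [rel_ker, ← U.map_comp_apply, ← U.map_comp_apply, comp_zero, comp_zero]

end InternalEquiv

theorem IsDifunctional.rel_ker_zero_le_comp [HasZeroMorphisms C] {W X Z : C} {f : W ⟶ X}
    {g : W ⟶ Z} (hd : IsDifunctional f g) (hp : IsRightPunctual f g) :
    (InternalEquiv.ker (0 : W ⟶ X)).rel U ≤
      Comp ((InternalEquiv.ker f).rel U) ((InternalEquiv.ker g).rel U) := by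
  intro a b hab
  obtain ⟨t, htg, htf⟩ := hp
  have g_section (c : U.obj W) : U.map g (U.map (g ≫ t) c) = U.map g c := by
    rw [← U.map_comp_apply, Category.assoc, htg, Category.comp_id]
  have f_section (c : U.obj W) : U.map f (U.map (g ≫ t) c) = U.map (0 : W ⟶ X) c := by
    rw [← U.map_comp_apply, Category.assoc, htf, comp_zero]
  have := hd.isIso
  have hzeta := (InternalEquiv.surjective_map_zeta_iff _ _).1
    ((isIso_iff_bijective (U.map (InternalEquiv.zeta (.ker f) (.ker g)))).1 inferInstance).2
  obtain ⟨c, hbc, hca⟩ := hzeta (U.map (g ≫ t) b) a ⟨U.map (g ≫ t) a,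
    InternalEquiv.rel_ker.2 (by rw [f_section, f_section, InternalEquiv.rel_ker.1 hab]),
    InternalEquiv.rel_ker.2 (g_section a)⟩
  rw [InternalEquiv.rel_ker, g_section] at hbc
  exact ⟨c, InternalEquiv.rel_ker.2 (InternalEquiv.rel_ker.1 hca).symm,
    InternalEquiv.rel_ker.2 hbc.symm⟩

end UnderlyingSets

/-! ### Points in a variety -/

namespace AlgVariety

section Forget

variable {L : FirstOrder.Language.{u, v}} [L.IsAlgebraic] {V : AlgVariety L}

instance : PreservesFiniteLimits (forget (Algebra.{u, v, w} V)) where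
  preservesFiniteLimits J _ _ := ⟨fun {F} => by
    refine preservesLimit_of_preserves_limit_cone (limitConeIsLimit F)
      ((Types.isLimit_iff_bijective_sectionOfCone _).2 ⟨fun x y h => ?_, fun s => ?_⟩).some
    · exact Subtype.ext (funext fun j => congrArg (fun s => s.1 j) h)
    · exact ⟨⟨s.1, s.2⟩, rfl⟩⟩

instance : (forget (Algebra.{u, v, w} V)).ReflectsIsomorphisms where
  reflects {A B} f _ := by
    have hf : Bijective f := (isIso_iff_bijective ((forget _).map f)).1 inferInstance
    let e : L.Equiv A B :=
      { Equiv.ofBijective f hf with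
        map_fun' := FirstOrder.Language.Hom.map_fun' f
        map_rel' := fun r => isEmptyElim r }
    exact ⟨e.symm.toHom, FirstOrder.Language.Hom.ext e.symm_apply_apply,
      FirstOrder.Language.Hom.ext e.apply_symm_apply⟩

end Forget

section Points

variable {L : FirstOrder.Language.{u, v}} [L.IsAlgebraic] {V : AlgVariety L}
  (Y : Algebra.{u, v, w} V)

/-- The functor sending a point over `Y` to its underlying set. -/
abbrev ptForget : PtFibre Y ⥤ Type w := Under.forget _ ⋙ Over.forget Y ⋙ forget (Algebra V)

instance : PreservesLimitsOfShape WalkingCospan (ptForget Y) := by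
  have : PreservesLimitsOfShape WalkingCospan (Under.forget (Over.mk (𝟙 Y))) := inferInstance
  infer_instance

variable {Y} {W X Z : PtFibre Y}

/-- The congruence on the underlying algebra of `W` given by an internal equivalence relation. -/
def ptCongruence (T : InternalEquiv W) : AlgCongruence L W.right.left where
  r := ptRel T
  iseqv := T.rel_equivalence (U := ptForget Y)
  map_fun f x y h := by
    choose t hx hy using h
    refine ⟨funMap f t, ?_, ?_⟩
    · exact (FirstOrder.Language.Hom.map_fun' T.d₀.right.left f t).trans (congrArg _ (funext hx))
    · exact (FirstOrder.Language.Hom.map_fun' T.d₁.right.left f t).trans (congrArg _ (funext hy))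

theorem IsCongruenceModular.ptRel_comp_le (hV : IsCongruenceModular.{u, v, w} V) {f : W ⟶ X}
    {g : W ⟶ Z} (hfg : IsRelationSpan f g) (hp : IsRightPunctual f g) (hd : IsDifunctional f g)
    (T : InternalEquiv W) :
    Comp (ptRel (.ker f)) (ptRel T) ≤ Comp (ptRel T) (ptRel (.ker f)) := by
  refine hV.comp_le_comp (a := ptCongruence (.ker f)) (b := ptCongruence (.ker g))
    (c := ptCongruence T) ?_ ?_
  · exact AlgCongruence.disjoint_iff_eq.2 fun x y hx hy => hfg.eq_of_map_eq (ptForget Y)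
      (InternalEquiv.rel_ker.1 hx) (InternalEquiv.rel_ker.1 hy)
  · have le_ker_zero (S : InternalEquiv W) :
        ptCongruence S ≤ ptCongruence (.ker (0 : W ⟶ X)) := fun _ _ h =>
      S.rel_le_rel_ker_zero (U := ptForget Y) X _ _ h
    exact fun x y h => hd.rel_ker_zero_le_comp (ptForget Y) hp x y
      (sup_le (le_ker_zero _) (le_ker_zero T) h)

theorem IsCongruenceModular.ptRel_comp_comm (hV : IsCongruenceModular.{u, v, w} V) {f : W ⟶ X}
    {g : W ⟶ Z} (hfg : IsRelationSpan f g) (hp : IsRightPunctual f g) (hd : IsDifunctional f g)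
    (T : InternalEquiv W) :
    Comp (ptRel (.ker f)) (ptRel T) = Comp (ptRel T) (ptRel (.ker f)) := by
  refine le_antisymm (hV.ptRel_comp_le hfg hp hd T) ?_
  rintro x z ⟨y, hxy, hyz⟩
  obtain ⟨q, hzq, hqx⟩ := hV.ptRel_comp_le hfg hp hd T z x
    ⟨y, (ptCongruence (.ker f)).iseqv.symm hyz, (ptCongruence T).iseqv.symm hxy⟩
  exact ⟨q, (ptCongruence (.ker f)).iseqv.symm hqx, (ptCongruence T).iseqv.symm hzq⟩

theorem IsCongruenceModular.axiomStar_ptFibre (hV : IsCongruenceModular.{u, v, w} V) :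
    AxiomStar (PtFibre Y) := fun _ _ _ _ _ hfg hp hd T =>
  extremalEpi_of_surjective_map (ptForget Y) _ <|
    (InternalEquiv.surjective_map_zeta_iff _ _).2 (hV.ptRel_comp_le hfg hp hd T)

end Points

end AlgVariety

theorem mainTheorem5 {L : FirstOrder.Language.{u, v}} [L.IsAlgebraic] (V : AlgVariety L)
    (hV : AlgVariety.IsCongruenceModular.{u, v, max u w} V)
    (Y : AlgVariety.Algebra.{u, v, max u w} V) :
    AxiomStar (PtFibre Y) ∧
      ∀ (W X Z : PtFibre Y) (f : W ⟶ X) (g : W ⟶ Z), IsRelationSpan f g → IsRightPunctual f g →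
        IsDifunctional f g → ∀ T : InternalEquiv W,
          Relation.Comp (AlgVariety.ptRel (InternalEquiv.ker f)) (AlgVariety.ptRel T) =
            Relation.Comp (AlgVariety.ptRel T) (AlgVariety.ptRel (InternalEquiv.ker f)) :=
  ⟨hV.axiomStar_ptFibre, fun _ _ _ _ _ hfg hp hd T => hV.ptRel_comp_comm hfg hp hd T⟩
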